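/- A planar lattice is a set $L=\{m\mathbf a+n\mathbf b: m,n\in\mathbb Z\}\subset\mathbb R^2$ with $\mathbf a,\mathbf b$ linearly independent; $D(L)=|\det(\mathbf a,\mathbf b)|$ is the area of a fundamental parallelogram. $L$ is integral if $\mathbf x\cdot\mathbf y\in\mathbb Z$ for all $\mathbf x,\mathbf y\in L$; then $D(L)^2$ is a positive integer, and $\nu(L)$ denotes its square-free part, i.e. the square-free integer with $D(L)^2=k^2\nu(L)$ for some integer $k$. $L$ is similar to $L'$ if for some $\lambda>0$ the lattice $\lambda L$ is isometric to $L'$. A polygon is contained in $L$ if all its vertices lie in $L$; it is equilateral if all its sides have the same positive length. Polygons are closed polygonal lines $A_1A_2\ldots A_n$, possibly self-intersecting; such a polygon is simple if its vertices are distinct and two different sides meet at most in a common end point. A convex polygon is one in which, for each side, all vertices not on that side lie strictly on one side of the line through it. **Theorem.** Let $n$ be an odd integer with $3\le n<17$. For a planar lattice $L$, the following are equivalent: (i) $L$ contains an equilateral $n$-gon (not necessarily convex, possibly self-intersecting); (i$'$) $L$ contains a simple equilateral $n$-gon; (ii) $L$ contains a convex equilateral $k$-gon for every integer $k\ge n$;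 (iii) $L$ is similar to an integral lattice $L'$ such that $\nu(L')\equiv 3\pmod 4$ and the largest prime factor $p$ of $\nu(L')$ satisfies $p\le n$. -/

import Mathlib

noncomputable section

namespace PlanarLattice

/-- The Euclidean plane. -/
abbrev Plane : Type := EuclideanSpace ℝ (Fin 2)

/-- The two by two determinant `det(u, v)`. -/
def cross (u v : Plane) : ℝ := u 0 * v 1 - u 1 * v 0

/-! ### Planar lattices -/

/-- A planar lattice: all integer combinations of two linearly independent vectors. -/
def IsPlanarLattice (L : Submodule ℤ Plane) : Prop :=
  ∃ a b : Plane, LinearIndependent ℝ ![a, b] ∧ L = Submodule.span ℤ {a, b}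

/-- `L` is integral: all inner products of its vectors are integers. -/
def IsIntegral (L : Submodule ℤ Plane) : Prop :=
  ∀ x ∈ L, ∀ y ∈ L, ∃ z : ℤ, inner ℝ x y = (z : ℝ)

/-- `L` is similar to `L'`: for some `c > 0` the scaled lattice `c L` is carried onto `L'` by an
isometry of the plane. -/
def IsSimilar (L L' : Submodule ℤ Plane) : Prop :=
  ∃ c : ℝ, 0 < c ∧ ∃ f : Plane ≃ᵢ Plane,
    (fun x : Plane => f (c • x)) '' (L : Set Plane) = (L' : Set Plane)

/-- `D(L)`: the area of a fundamental parallelogram of `L`. -/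
def area (L : Submodule ℤ Plane) : ℝ := ZLattice.covolume L

/-- `m` is a square-free part of the real number `x`: `m` is square-free and `x = k² m` for some
integer `k`. -/
def IsSquarefreePart (m : ℕ) (x : ℝ) : Prop :=
  Squarefree m ∧ ∃ k : ℤ, x = (k : ℝ) ^ 2 * (m : ℝ)

open Classical in
/-- `ν(L)`: the square-free part of `D(L)²`. For a planar integral lattice it exists and is unique
(`existsUnique_isSquarefreePart` below); where there is none, the value is `0`. -/
def nu (L : Submodule ℤ Plane) : ℕ :=
  if h : ∃ m : ℕ, IsSquarefreePart m (area L ^ 2) then h.choose else 0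

/-- A nonzero number has at most one square-free part. -/
theorem isSquarefreePart_unique {m m' : ℕ} {x : ℝ} (hx : x ≠ 0) (h : IsSquarefreePart m x)
    (h' : IsSquarefreePart m' x) : m = m' := by
  obtain ⟨h1, k, hk⟩ := h
  obtain ⟨h1', k', hk'⟩ := h'
  have e : (k.natAbs) ^ 2 * m = k'.natAbs ^ 2 * m' := by
    have : (k:ℝ)^2 * m = (k':ℝ)^2 * m' := by rw [← hk, ← hk']
    have h2 : k^2 * (m:ℤ) = k'^2 * m' := by exact_mod_cast this
    zify; simpa using h2
  have hk0 : k.natAbs ≠ 0 := by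
    rintro h; apply hx; rw [hk]; simp [Int.natAbs_eq_zero.mp h]
  have hk0' : k'.natAbs ≠ 0 := by
    rintro h; apply hx; rw [hk']; simp [Int.natAbs_eq_zero.mp h]
  have hm : m ≠ 0 := h1.ne_zero
  have hm' : m' ≠ 0 := h1'.ne_zero
  apply Nat.eq_of_factorization_eq hm hm'
  intro p
  have := congrArg (fun t => t.factorization p) e
  simp [Nat.factorization_mul, hk0, hk0', hm, hm'] at this
  have a1 := h1.natFactorization_le_one p
  have a2 := h1'.natFactorization_le_one p
  omega

/-- `D(L[a, b]) = |det(a, b)|`. -/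
theorem area_span (a b : Plane) (h : LinearIndependent ℝ ![a, b]) :
    area (Submodule.span ℤ {a, b}) = |cross a b| := by
  have hc : Fintype.card (Fin 2) = Module.finrank ℝ Plane := by simp
  let B : Module.Basis (Fin 2) ℝ Plane := basisOfLinearIndependentOfCardEqFinrank h hc
  have hB : ⇑B = ![a, b] := coe_basisOfLinearIndependentOfCardEqFinrank h hc
  have hs : ({a, b} : Set Plane) = Set.range B := by
    rw [hB]; simp [Matrix.range_cons, Set.pair_comm]
  rw [area, hs, ZLattice.covolume_eq_det_mul_measureReal (Submodule.span ℤ (Set.range B)) MeasureTheory.volume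
    (B.restrictScalars ℤ) (EuclideanSpace.basisFun (Fin 2) ℝ).toBasis]
  have h1 : (MeasureTheory.volume : MeasureTheory.Measure Plane).real
      (ZSpan.fundamentalDomain (EuclideanSpace.basisFun (Fin 2) ℝ).toBasis) = 1 := by
    rw [MeasureTheory.measureReal_congr (ZSpan.fundamentalDomain_ae_parallelepiped _ _)]
    have := (EuclideanSpace.basisFun (Fin 2) ℝ).volume_parallelepiped
    simp [MeasureTheory.Measure.real, this]
  have h2 : ((↑) : Submodule.span ℤ (Set.range B) → Plane) ∘ (B.restrictScalars ℤ) = ![a, b] := by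
    rw [← hB]; ext1 i; simp
  rw [h1, mul_one, h2, Module.Basis.det_apply, Matrix.det_fin_two]
  simp [cross, Module.Basis.toMatrix_apply]
  ring_nf

/-- For a planar integral lattice the square-free part of `D(L)²` exists and is unique. -/
theorem existsUnique_isSquarefreePart (L : Submodule ℤ Plane) (hL : IsPlanarLattice L)
    (hI : IsIntegral L) : ∃! m : ℕ, IsSquarefreePart m (area L ^ 2) := by
  obtain ⟨a, b, hab, rfl⟩ := hL
  have hb := area_span a b hab
  have ha0 : area (Submodule.span ℤ {a, b}) ^ 2 ≠ 0 := by
    rw [hb, sq_abs]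
    intro h0
    have h0 : a 0 * b 1 - a 1 * b 0 = 0 := by simpa [cross] using h0
    rw [LinearIndependent.pair_iff] at hab
    have e1 := hab (b 1) (-(a 1)) (by
      ext i; fin_cases i <;> simp <;> linarith)
    have e2 := hab (b 0) (-(a 0)) (by
      ext i; fin_cases i <;> simp <;> linarith)
    have e3 := hab 1 0 (by
      ext i; fin_cases i <;> simp
      · linarith [e2.2]
      · linarith [e1.2])
    exact one_ne_zero e3.1
  have ma : a ∈ Submodule.span ℤ {a, b} := Submodule.subset_span (by simp)
  have mb : b ∈ Submodule.span ℤ {a, b} := Submodule.subset_span (by simp)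
  obtain ⟨x, hx⟩ := hI a ma a ma
  obtain ⟨y, hy⟩ := hI a ma b mb
  obtain ⟨z, hz⟩ := hI b mb b mb
  have e : area (Submodule.span ℤ {a, b}) ^ 2 = ((x * z - y ^ 2 : ℤ) : ℝ) := by
    rw [hb, sq_abs]
    push_cast
    rw [← hx, ← hy, ← hz]
    simp only [cross, PiLp.inner_apply, Fin.sum_univ_two, RCLike.inner_apply, conj_trivial]
    ring
  have hpos : 0 ≤ x * z - y ^ 2 := by
    have : (0:ℝ) ≤ ((x * z - y ^ 2 : ℤ) : ℝ) := by rw [← e]; positivity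
    exact_mod_cast this
  obtain ⟨N, hN⟩ := Int.eq_ofNat_of_zero_le hpos
  obtain ⟨m, k, hmk, hm⟩ := Nat.sq_mul_squarefree N
  refine ⟨m, ⟨hm, k, ?_⟩, fun m' hm' => isSquarefreePart_unique ha0 hm' ⟨hm, k, ?_⟩⟩ <;>
  · rw [e, hN, ← hmk]; push_cast; rfl

/-- `ν(L)` is the square-free part of `D(L)²`. -/
theorem nu_spec (L : Submodule ℤ Plane) (hL : IsPlanarLattice L) (hI : IsIntegral L) :
    IsSquarefreePart (nu L) (area L ^ 2) := by
  have h := (existsUnique_isSquarefreePart L hL hI).exists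
  rw [nu, dif_pos h]
  exact h.choose_spec

/-! ### Polygons

An `n`-gon (`n ≥ 3`) is given by its vertices `P 0, …, P (n - 1)` in cyclic order; the successor of
the index `i` is `finRotate n i`, and the sides are the segments from `P i` to its successor. -/

/-- The polygon `P` is contained in `L`: every vertex is in `L`. -/
def ContainedIn {n : ℕ} (P : Polygon Plane n) (L : Submodule ℤ Plane) : Prop :=
  ∀ i, P i ∈ L

/-- All sides of `P` have the same (positive) length. -/
def IsEquilateral {n : ℕ} (P : Polygon Plane n) : Prop :=
  ∃ r : ℝ, 0 < r ∧ ∀ i, dist (P i) (P (finRotate n i)) = r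

/-- `P` is simple: its vertices are distinct, and two different sides meet at most in a common
end point. -/
def IsSimple {n : ℕ} (P : Polygon Plane n) : Prop :=
  Function.Injective P.vertices ∧
    ∀ i j, i ≠ j → P.edgeSet ℝ i ∩ P.edgeSet ℝ j ⊆
      {P i, P (finRotate n i)} ∩ {P j, P (finRotate n j)}

/-- `P` is a convex polygon (`n ≥ 3`): for each side, all the vertices that are not on that side
lie strictly on one and the same side of the line through it. -/
def IsConvexPolygon {n : ℕ} (P : Polygon Plane n) : Prop :=
  ∀ i, (∀ j, j ≠ i → j ≠ finRotate n i → 0 < cross (P (finRotate n i) - P i) (P j - P i)) ∨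
    (∀ j, j ≠ i → j ≠ finRotate n i → cross (P (finRotate n i) - P i) (P j - P i) < 0)

end PlanarLattice

end

/-! The side vectors of an equilateral n-gon in `L` are n lattice vectors of one length with sum
zero, so everything is about such families.

Necessity: when n is odd, a parity argument yields three pairwise non-parallel sides. A rational
linear relation between them makes the inner product of two of them a rational multiple of the
squared length, so the Gram matrix of `L` is integral up to scaling (`exists_gram_of_sum_eq_zero`).
With m = ν, inner products and determinants against one fixed side turn the family into integers
with X² + mY² = N² and ΣX = ΣY = 0, that is, elements of equal norm in ℚ(√-m). After common factors
are removed, a prime p dividing m gives X ≡ ±N (mod p), so p divides a sum of n signs, which is odd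
and hence nonzero: p ≤ n (`prime_le_card`). Parity excludes m even and m ≡ 1 (mod 4)
(`mod_four_eq_three`).

Sufficiency: distinct norm-one elements of ℚ(√-m) with sum zero map linearly to lattice vectors of
equal length; sorted by argument, these bound a convex polygon. As n < 17, only sixteen values of m
occur. Each has an explicit cycle whose length is a prime factor of m, and pairs w, -w lengthen it
(`exists_isUnitCycle`). Convex polygons are simple, which closes the circle. -/

noncomputable section

namespace PlanarLattice

/-! ### Sums of elements of equal norm in an imaginary quadratic field -/

/-- Common factors can be removed from a family of solutions of `X² + m Y² = N²`. -/
theorem exists_reduced_family {ι : Type*} [Fintype ι] {m : ℤ} {q : ℕ} (hq : q.Prime)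
    (H : ∀ X Y N : ℤ, X ^ 2 + m * Y ^ 2 = N ^ 2 → (q : ℤ) ∣ N → (q : ℤ) ∣ X ∧ (q : ℤ) ∣ Y)
    {N : ℤ} (hN : N ≠ 0) {X Y : ι → ℤ} (h : ∀ i, X i ^ 2 + m * Y i ^ 2 = N ^ 2)
    (hX : ∑ i, X i = 0) (hY : ∑ i, Y i = 0) :
    ∃ (N' : ℤ) (X' Y' : ι → ℤ), ¬ (q : ℤ) ∣ N' ∧ (∀ i, X' i ^ 2 + m * Y' i ^ 2 = N' ^ 2) ∧
      ∑ i, X' i = 0 ∧ ∑ i, Y' i = 0 := by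
  -- Descent on |N|: if q divides N, it divides every X i and Y i, and dividing by q gives a smaller
  -- family.
  induction hk : N.natAbs using Nat.strong_induction_on generalizing N X Y with
  | _ k ih =>
    by_cases hd : (q : ℤ) ∣ N
    · choose X' hX' using fun i => (H _ _ _ (h i) hd).1
      choose Y' hY' using fun i => (H _ _ _ (h i) hd).2
      obtain ⟨N', rfl⟩ := hd
      have hq0 : (q : ℤ) ≠ 0 := by exact_mod_cast hq.ne_zero
      have hN' : N' ≠ 0 := right_ne_zero_of_mul hN
      refine ih N'.natAbs ?_ hN' (X := X') (Y := Y') (fun i => ?_) ?_ ?_ rfl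
      · rw [← hk, Int.natAbs_mul, Int.natAbs_natCast]
        have := Int.natAbs_pos.mpr hN'
        nlinarith [hq.two_le]
      · have := h i
        rw [hX', hY'] at this
        apply mul_left_cancel₀ (pow_ne_zero 2 hq0)
        linear_combination this
      · simp only [hX', ← Finset.mul_sum] at hX
        exact (mul_eq_zero.mp hX).resolve_left hq0
      · simp only [hY', ← Finset.mul_sum] at hY
        exact (mul_eq_zero.mp hY).resolve_left hq0
    · exact ⟨N, X, Y, hd, h, hX, hY⟩

/-- First p divides X², hence X; then p² divides mY², and p² does not divide m, so p divides Y. This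
is the divisibility hypothesis of `exists_reduced_family`. -/
theorem dvd_of_prime_dvd_squarefree {m p : ℕ} (hm : Squarefree m) (hp : p.Prime) (hpm : p ∣ m)
    (X Y N : ℤ) (h : X ^ 2 + m * Y ^ 2 = N ^ 2) (hN : (p : ℤ) ∣ N) :
    (p : ℤ) ∣ X ∧ (p : ℤ) ∣ Y := by
  have hp' : Prime (p : ℤ) := Nat.prime_iff_prime_int.mp hp
  obtain ⟨c, rfl⟩ := hpm
  obtain ⟨N, rfl⟩ := hN
  have hX : (p : ℤ) ∣ X := by
    apply hp'.dvd_of_dvd_pow (n := 2)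
    exact ⟨p * N ^ 2 - c * Y ^ 2, by push_cast at h; linear_combination h⟩
  refine ⟨hX, ?_⟩
  obtain ⟨X, rfl⟩ := hX
  have h1 : (p : ℤ) ∣ c * Y ^ 2 := by
    refine ⟨N ^ 2 - X ^ 2, ?_⟩
    apply mul_left_cancel₀ hp'.ne_zero
    push_cast at h
    linear_combination h
  rcases hp'.dvd_or_dvd h1 with h2 | h2
  · exfalso
    have h3 : p ∣ c := by exact_mod_cast h2
    have := hm p (Nat.mul_dvd_mul_left p h3)
    exact hp.one_lt.ne' (Nat.isUnit_iff.mp this)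
  · exact hp'.dvd_of_dvd_pow h2

theorem odd_sum_of_odd {ι : Type*} [Fintype ι] (hn : Odd (Fintype.card ι)) {f : ι → ℤ}
    (hf : ∀ i, Odd (f i)) : Odd (∑ i, f i) := by
  choose g hg using hf
  obtain ⟨c, hc⟩ := hn
  refine ⟨∑ i, g i + c, ?_⟩
  simp only [hg, Finset.sum_add_distrib, ← Finset.mul_sum, Finset.sum_const, Finset.card_univ, hc]
  simp
  ring

/-- An odd prime factor of `m` is at most the number of summands in a vanishing sum of an odd
number of elements of equal norm in `ℚ(√-m)`. -/
theorem prime_le_card {ι : Type*} [Fintype ι] (hn : Odd (Fintype.card ι)) {m : ℕ}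
    (hm : Squarefree m) {N : ℤ} (hN : N ≠ 0) {X Y : ι → ℤ}
    (h : ∀ i, X i ^ 2 + m * Y i ^ 2 = N ^ 2) (hX : ∑ i, X i = 0) (hY : ∑ i, Y i = 0)
    {p : ℕ} (hp : p.Prime) (hpm : p ∣ m) : p ≤ Fintype.card ι := by
  obtain ⟨N, X, Y, hN, h, hX, -⟩ := exists_reduced_family hp
    (dvd_of_prime_dvd_squarefree hm hp hpm) hN h hX hY
  have hp' : Prime (p : ℤ) := Nat.prime_iff_prime_int.mp hp
  -- Modulo p the equation reads X² = N².
  have key : ∀ i, ∃ e : ℤ, (e = 1 ∨ e = -1) ∧ (p : ℤ) ∣ X i - e * N := by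
    intro i
    obtain ⟨c, hc⟩ := hpm
    have : (p : ℤ) ∣ (X i - N) * (X i + N) :=
      ⟨-(c * Y i ^ 2), by have := h i; rw [hc] at this; push_cast at this; linear_combination this⟩
    rcases hp'.dvd_or_dvd this with h1 | h1
    · exact ⟨1, Or.inl rfl, by simpa using h1⟩
    · exact ⟨-1, Or.inr rfl, by simpa using h1⟩
  choose e he hd using key
  have hs : (p : ℤ) ∣ ∑ i, e i := by
    have h1 : (p : ℤ) ∣ ∑ i, (X i - e i * N) := Finset.dvd_sum fun i _ => hd i
    rw [Finset.sum_sub_distrib, hX, ← Finset.sum_mul, zero_sub, dvd_neg] at h1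
    exact (hp'.dvd_or_dvd h1).resolve_right hN
  have ho : Odd (∑ i, e i) := odd_sum_of_odd hn fun i => by
    rcases he i with h | h <;> rw [h] <;> decide
  have hne : ∑ i, e i ≠ 0 := by
    intro h0
    rw [h0] at ho
    exact absurd ho (by decide)
  have hle : |∑ i, e i| ≤ Fintype.card ι := by
    refine (Finset.abs_sum_le_sum_abs _ _).trans ?_
    have : ∀ i, |e i| = 1 := fun i => by rcases he i with h | h <;> simp [h]
    simp [this]
  have := Int.le_of_dvd (abs_pos.mpr hne) ((dvd_abs _ _).mpr hs)
  exact_mod_cast this.trans hle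

/-- A vanishing sum of an odd number of elements of equal norm in `ℚ(√-m)` forces
`m ≡ 3 (mod 4)`. -/
theorem mod_four_eq_three {ι : Type*} [Fintype ι] (hn : Odd (Fintype.card ι)) {m : ℕ}
    (hm : Squarefree m) {N : ℤ} (hN : N ≠ 0) {X Y : ι → ℤ}
    (h : ∀ i, X i ^ 2 + m * Y i ^ 2 = N ^ 2) (hX : ∑ i, X i = 0) (hY : ∑ i, Y i = 0) :
    m % 4 = 3 := by
  have h4 : m % 4 ≠ 0 := by
    intro h0
    have := hm 2 (Nat.dvd_of_mod_eq_zero h0)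
    exact absurd (Nat.isUnit_iff.mp this) (by decide)
  by_contra h3
  -- For m even, N can be taken odd, so all X are odd and an odd number of them cannot sum to zero.
  -- For m ≡ 1 (mod 4), the same applies to X + Y.
  rcases Nat.even_or_odd m with he | ho
  · have h2 : 2 ∣ m := he.two_dvd
    obtain ⟨N, X, Y, hN, h, hX, -⟩ := exists_reduced_family Nat.prime_two
      (dvd_of_prime_dvd_squarefree hm Nat.prime_two h2) hN h hX hY
    have : Odd (∑ i, X i) := odd_sum_of_odd hn fun i => by
      have hNo : Odd N := by
        rw [← Int.not_even_iff_odd, even_iff_two_dvd]; exact hN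
      have h5 : Even ((m : ℤ) * Y i ^ 2) := (Int.even_coe_nat m |>.mpr he).mul_right _
      have h6 : Odd (X i ^ 2) := by
        have : X i ^ 2 = N ^ 2 - m * Y i ^ 2 := by linear_combination h i
        rw [this]; exact hNo.pow.sub_even h5
      exact (Int.odd_pow' (by norm_num)).mp h6
    rw [hX] at this
    exact absurd this (by decide)
  · have h1 : m % 4 = 1 := by have := Nat.odd_iff.mp ho; omega
    have hmc : ((m : ℤ) : ZMod 4) = 1 := by
      have : ((m : ℕ) : ZMod 4) = ((1 : ℕ) : ZMod 4) := (ZMod.natCast_eq_natCast_iff' _ _ _).mpr h1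
      simpa using this
    obtain ⟨N, X, Y, hN, h, hX, hY⟩ := exists_reduced_family Nat.prime_two
      (m := m) (fun X Y N h hN => by
        obtain ⟨N, rfl⟩ := hN
        have h5 := congrArg (Int.cast : ℤ → ZMod 4) h
        push_cast at h5 hmc
        rw [hmc] at h5
        -- In `ZMod 4` the equation 2x = 0 says that x is even: two squares sum to 0 modulo 4 only
        -- if both roots are even.
        have key : ∀ x y n : ZMod 4, x ^ 2 + 1 * y ^ 2 = (2 * n) ^ 2 →
            2 * x = 0 ∧ 2 * y = 0 := by decide
        have h6 := key _ _ _ h5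
        have h7 : ((2 * X : ℤ) : ZMod 4) = 0 := by push_cast; exact h6.1
        have h8 : ((2 * Y : ℤ) : ZMod 4) = 0 := by push_cast; exact h6.2
        rw [ZMod.intCast_zmod_eq_zero_iff_dvd] at h7 h8
        push_cast at h7 h8 ⊢
        omega) hN h hX hY
    have : Odd (∑ i, (X i + Y i)) := odd_sum_of_odd hn fun i => by
      have hNo : Odd N := by
        rw [← Int.not_even_iff_odd, even_iff_two_dvd]; exact hN
      have h6 : Odd (X i ^ 2 + m * Y i ^ 2) := by rw [h i]; exact hNo.pow
      have hmo : Odd (m : ℤ) := by exact_mod_cast ho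
      have hm' : ¬ Even (m : ℤ) := Int.not_even_iff_odd.mpr hmo
      simp only [← Int.not_even_iff_odd, Int.even_add, Int.even_pow, Int.even_mul, hm'] at h6 ⊢
      simpa using h6
    rw [Finset.sum_add_distrib, hX, hY] at this
    exact absurd this (by decide)

/-! ### Distinct elements of norm one with vanishing sum -/

/-- `S` is a finite set of elements `x + y √-m` of norm one of `ℚ(√-m)` with vanishing sum. -/
def IsUnitCycle (m : ℕ) (S : Finset (ℚ × ℚ)) : Prop :=
  (∀ v ∈ S, v.1 ^ 2 + m * v.2 ^ 2 = 1) ∧ ∑ v ∈ S, v = 0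

/-- The list `l` consists of distinct integral elements `X + Y √-m` of norm `N²` with vanishing
sum. -/
def IsIntegralCycle (m : ℕ) (N : ℤ) (l : List (ℤ × ℤ)) : Prop :=
  0 < N ∧ l.Nodup ∧ (∀ v ∈ l, v.1 ^ 2 + m * v.2 ^ 2 = N ^ 2) ∧ l.sum = 0

instance (m : ℕ) (N : ℤ) (l : List (ℤ × ℤ)) : Decidable (IsIntegralCycle m N l) := by
  unfold IsIntegralCycle; infer_instance

/-- The number `N` together with the elements of `l` and their conjugates. -/
def conjClosure (N : ℤ) (l : List (ℤ × ℤ)) : List (ℤ × ℤ) :=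
  (N, 0) :: (l ++ l.map fun v => (v.1, -v.2))

/-- An odd number of the primes 3, 7, 11 and any of 5, 13 give the sixteen values of m. The length
is a prime factor of m, hence at most any n that bounds these factors. In a list closed under
conjugation the Y-coordinates cancel, leaving only N + 2ΣX = 0; the cycle for m = 15 is not of this
kind. -/
theorem exists_isIntegralCycle {m : ℕ} (hm : Squarefree m)
    (hp : m.primeFactors ⊆ {3, 5, 7, 11, 13}) (h4 : m % 4 = 3) :
    ∃ (N : ℤ) (l : List (ℤ × ℤ)), IsIntegralCycle m N l ∧ l.length.Prime ∧ l.length ∣ m ∧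
      Odd l.length := by
  have key : ∀ S ∈ ({3, 5, 7, 11, 13} : Finset ℕ).powerset, (∏ p ∈ S, p) % 4 = 3 →
      (∏ p ∈ S, p) ∈ [3, 7, 11, 15, 35, 39, 55, 91, 143, 195, 231, 455, 715, 1155, 3003, 15015] := by
    decide
  have hmem := key _ (Finset.mem_powerset.mpr hp)
  rw [Nat.prod_primeFactors_of_squarefree hm] at hmem
  have hmem := hmem h4
  simp only [List.mem_cons, List.not_mem_nil, or_false] at hmem
  rcases hmem with rfl | rfl | rfl | rfl | rfl | rfl | rfl | rfl | rfl | rfl | rfl | rfl | rfl |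
    rfl | rfl | rfl
  · exact ⟨2, conjClosure 2 [(-1, 1)], by decide +kernel, by decide, by decide, by decide⟩
  · exact ⟨88, conjClosure 88 [(-87, 5), (-38, 30), (81, 13)], by decide +kernel, by decide,
      by decide, by decide⟩
  · exact ⟨90, conjClosure 90 [(-86, 8), (-42, 24), (-9, 27), (35, 25), (57, 21)],
      by decide +kernel, by decide, by decide, by decide⟩
  · exact ⟨967448, [(967448, 0), (890258, -97774), (-897512, 93248), (-495427, -214555),
      (-464767, 219081)], by decide +kernel, by decide, by decide, by decide⟩
  · exact ⟨17226, conjClosure 17226 [(-17081, 377), (13194, 1872), (-4726, 2800)],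
      by decide +kernel, by decide, by decide, by decide⟩
  · exact ⟨440, conjClosure 440 [(-418, 22), (-392, 32), (-275, 55), (154, 66), (310, 50),
      (401, 29)], by decide +kernel, by decide, by decide, by decide⟩
  · exact ⟨728, conjClosure 728 [(-702, 26), (-658, 42), (-273, 91), (552, 64), (717, 17)],
      by decide +kernel, by decide, by decide, by decide⟩
  · exact ⟨16790, conjClosure 16790 [(-16698, 184), (-5037, 1679), (150, 1760), (1606, 1752),
      (3335, 1725), (8249, 1533)], by decide +kernel, by decide, by decide, by decide⟩
  · exact ⟨7056, conjClosure 7056 [(-7023, 57), (-6594, 210), (-4592, 448), (2844, 540),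
      (5418, 378), (6419, 245)], by decide +kernel, by decide, by decide, by decide⟩
  · exact ⟨1666, conjClosure 1666 [(-1649, 17), (-1519, 49), (-791, 105), (119, 119), (1406, 64),
      (1601, 33)], by decide +kernel, by decide, by decide, by decide⟩
  · exact ⟨800, conjClosure 800 [(-740, 20), (-520, 40), (-124, 52), (415, 45), (569, 37)],
      by decide +kernel, by decide, by decide, by decide⟩
  · exact ⟨4896, conjClosure 4896 [(-4854, 30), (-4581, 81), (-3944, 136), (3336, 168),
      (3531, 159), (4064, 128)], by decide +kernel, by decide, by decide, by decide⟩
  · exact ⟨1861126, conjClosure 1861126 [(-670871, 64923), (1383181, 46569), (1395479, 46053),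
      (-1687029, 29393), (450106, 67536), (-1801429, 17487)], by decide +kernel, by decide,
      by decide, by decide⟩
  · exact ⟨1530374, conjClosure 1530374 [(-1388234, 18952), (-796214, 38456), (336566, 43928),
      (1455761, 13889), (-373066, 43672)], by decide +kernel, by decide, by decide, by decide⟩
  · exact ⟨755352386, conjClosure 755352386 [(247443023, 13023317), (-276880777, 12824467),
      (398914343, 11704893), (209585203, 13242673), (-355520338, 12161672),
      (-601217647, 8344373)], by decide +kernel, by decide, by decide, by decide⟩
  · exact ⟨14027080064, conjClosure 14027080064 [(9745887616, 82330624),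
      (-5437546936, 105522520), (-12069127606, 58334718), (-12019052581, 59019263),
      (14012993459, 5128969), (-1246693984, 114020384)], by decide +kernel, by decide, by decide,
      by decide⟩

theorem IsIntegralCycle.exists_isUnitCycle {m : ℕ} {N : ℤ} {l : List (ℤ × ℤ)}
    (h : IsIntegralCycle m N l) : ∃ S : Finset (ℚ × ℚ), S.card = l.length ∧ IsUnitCycle m S := by
  obtain ⟨hN, hd, hv, hs⟩ := h
  have hN' : (N : ℚ) ≠ 0 := by exact_mod_cast hN.ne'
  let f : ℤ × ℤ →+ ℚ × ℚ :=
    { toFun := fun v => ((v.1 : ℚ) / N, (v.2 : ℚ) / N)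
      map_zero' := by simp
      map_add' := fun v w => by ext <;> simp [add_div] }
  have hf : Function.Injective f := fun v w hvw => by
    have h1 : (v.1 : ℚ) / N = w.1 / N := congrArg Prod.fst hvw
    have h2 : (v.2 : ℚ) / N = w.2 / N := congrArg Prod.snd hvw
    rw [div_left_inj' hN'] at h1 h2
    ext
    · exact_mod_cast h1
    · exact_mod_cast h2
  refine ⟨l.toFinset.image f, ?_, ?_, ?_⟩
  · rw [Finset.card_image_of_injective _ hf, List.toFinset_card_of_nodup hd]
  · intro v hv'
    simp only [Finset.mem_image, List.mem_toFinset] at hv'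
    obtain ⟨w, hw, rfl⟩ := hv'
    have h1 : ((w.1 : ℚ)) ^ 2 + m * (w.2 : ℚ) ^ 2 = N ^ 2 := by exact_mod_cast hv w hw
    change ((w.1 : ℚ) / N) ^ 2 + m * ((w.2 : ℚ) / N) ^ 2 = 1
    field_simp
    linarith
  · rw [Finset.sum_image hf.injOn, ← map_sum, List.sum_toFinset _ hd]
    simp [hs]

/-- The conic x² + my² = 1 is parametrized by the slope t of the lines through (-1, 0). -/
theorem infinite_norm_one {m : ℕ} (hm : 0 < m) :
    {v : ℚ × ℚ | v.1 ^ 2 + m * v.2 ^ 2 = 1}.Infinite := by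
  have hpos : ∀ t : ℚ, 0 < 1 + m * t ^ 2 := fun t => by positivity
  refine Set.infinite_of_injective_forall_mem
    (f := fun t : ℚ => ((1 - m * t ^ 2) / (1 + m * t ^ 2), 2 * t / (1 + m * t ^ 2))) ?_ ?_
  · intro s t hst
    simp only [Prod.mk.injEq] at hst
    obtain ⟨h1, h2⟩ := hst
    have hs := (hpos s).ne'
    have ht := (hpos t).ne'
    have hm' : (m : ℚ) ≠ 0 := by positivity
    rw [div_eq_div_iff hs ht] at h1 h2
    have h3 : (m : ℚ) * t ^ 2 = m * s ^ 2 := by linarith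
    rw [h3] at h2
    have := mul_right_cancel₀ hs h2
    linarith
  · intro t
    have ht := (hpos t).ne'
    simp only [Set.mem_ofPred_eq]
    field_simp
    ring

theorem IsUnitCycle.exists_card_add_two {m : ℕ} (hm : 0 < m) {S : Finset (ℚ × ℚ)}
    (hS : IsUnitCycle m S) : ∃ S' : Finset (ℚ × ℚ), S'.card = S.card + 2 ∧ IsUnitCycle m S' := by
  classical
  -- Avoiding both S and -S makes w and -w new elements, and together they add zero to the sum.
  obtain ⟨w, hw, hwS⟩ := (infinite_norm_one hm).exists_notMem_finset (S ∪ S.image (fun v => -v))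
  simp only [Finset.mem_union, Finset.mem_image, not_or, not_exists, not_and] at hwS
  obtain ⟨h1, h2⟩ := hwS
  have h3 : -w ∉ S := fun h => h2 _ h (neg_neg w)
  have hw' : w.1 ^ 2 + m * w.2 ^ 2 = 1 := hw
  have h4 : w ∉ insert (-w) S := by
    rw [Finset.mem_insert, not_or]
    refine ⟨fun h => ?_, h1⟩
    have ha : w.1 = -w.1 := congrArg Prod.fst h
    have hb : w.2 = -w.2 := congrArg Prod.snd h
    have ha : w.1 = 0 := by linarith
    have hb : w.2 = 0 := by linarith
    rw [ha, hb] at hw'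
    norm_num at hw'
  refine ⟨insert w (insert (-w) S), ?_, ?_, ?_⟩
  · rw [Finset.card_insert_of_notMem h4, Finset.card_insert_of_notMem h3]
  · intro v hv
    simp only [Finset.mem_insert] at hv
    rcases hv with rfl | rfl | hv
    · exact hw'
    · simpa using hw'
    · exact hS.1 v hv
  · rw [Finset.sum_insert h4, Finset.sum_insert h3, hS.2]
    simp

theorem IsUnitCycle.exists_card_add_two_mul {m : ℕ} (hm : 0 < m) {S : Finset (ℚ × ℚ)}
    (hS : IsUnitCycle m S) (j : ℕ) :
    ∃ S' : Finset (ℚ × ℚ), S'.card = S.card + 2 * j ∧ IsUnitCycle m S' := by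
  induction j with
  | zero => exact ⟨S, rfl, hS⟩
  | succ j ih =>
    obtain ⟨S', hc, hS'⟩ := ih
    obtain ⟨S'', hc', hS''⟩ := hS'.exists_card_add_two hm
    exact ⟨S'', by omega, hS''⟩

/-- For `m ≡ 3 (mod 4)` with prime factors at most `n < 17`, there are vanishing sums of `k ≥ n`
distinct elements of norm one of `ℚ(√-m)`. -/
theorem exists_isUnitCycle {m n k : ℕ} (hm : Squarefree m) (h4 : m % 4 = 3) (hn : n < 17)
    (hp : ∀ p : ℕ, p.Prime → p ∣ m → p ≤ n) (hk : n ≤ k) :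
    ∃ S : Finset (ℚ × ℚ), S.card = k ∧ IsUnitCycle m S := by
  have hm0 : 0 < m := by omega
  rcases Nat.even_or_odd k with ⟨j, hj⟩ | hk'
  · obtain ⟨S, hc, hS⟩ := IsUnitCycle.exists_card_add_two_mul (S := ∅) hm0
      ⟨by simp, by simp⟩ j
    exact ⟨S, by rw [hc, hj]; simp; ring, hS⟩
  · have hsub : m.primeFactors ⊆ {3, 5, 7, 11, 13} := by
      intro q hq
      have hq1 := Nat.prime_of_mem_primeFactors hq
      have hq2 := Nat.dvd_of_mem_primeFactors hq
      have hq3 := hp q hq1 hq2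
      have hq4 : q < 17 := by omega
      have hq5 : q ≠ 2 := by rintro rfl; omega
      interval_cases q <;> first | decide | (exfalso; revert hq1; decide) | exact absurd rfl hq5
    obtain ⟨N, l, hl, hl1, hl2, hl3⟩ := exists_isIntegralCycle hm hsub h4
    obtain ⟨S, hc, hS⟩ := hl.exists_isUnitCycle
    have hle : l.length ≤ k := (hp _ hl1 hl2).trans hk
    obtain ⟨a, ha⟩ := hl3
    obtain ⟨b, hb⟩ := hk'
    obtain ⟨S', hc', hS'⟩ := hS.exists_card_add_two_mul hm0 (b - a)
    exact ⟨S', by omega, hS'⟩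

/-! ### Convex polygons with prescribed sides -/

theorem cross_sub_right (u v w : Plane) : cross u (v - w) = cross u v - cross u w := by
  simp [cross]; ring

theorem cross_sum_right {ι : Type*} (s : Finset ι) (u : Plane) (f : ι → Plane) :
    cross u (∑ i ∈ s, f i) = ∑ i ∈ s, cross u (f i) := by
  classical
  induction s using Finset.induction_on with
  | empty => simp [cross]
  | insert a s ha ih =>
    rw [Finset.sum_insert ha, Finset.sum_insert ha, ← ih]
    simp [cross]; ring

theorem cross_self (u : Plane) : cross u u = 0 := by
  simp [cross]; ring

/-- If angles in `(0, 2π)` have sines with vanishing sum, then the sines of a proper initial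
part of them have positive sum. -/
theorem sum_sin_pos {ι : Type*} {T T' : Finset ι} {φ : ι → ℝ} (hT : ∀ l ∈ T, 0 < φ l)
    (hT' : ∀ l ∈ T', φ l < 2 * Real.pi) (hlt : ∀ l ∈ T, ∀ l' ∈ T', φ l < φ l')
    (hne : T.Nonempty) (hne' : T'.Nonempty)
    (hsum : ∑ l ∈ T, Real.sin (φ l) + ∑ l ∈ T', Real.sin (φ l) = 0) :
    0 < ∑ l ∈ T, Real.sin (φ l) := by
  -- An angle of T that is at least π forces all of T' into (π, 2π), where sines are negative;
  -- otherwise T lies in (0, π).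
  by_cases h : ∃ l ∈ T, Real.pi ≤ φ l
  · obtain ⟨l, hl, hpi⟩ := h
    have : 0 < ∑ l ∈ T', -Real.sin (φ l) := Finset.sum_pos (fun l' hl' => by
      have h1 := hlt l hl l' hl'
      have h2 := hT' l' hl'
      have h3 := Real.sin_pos_of_pos_of_lt_pi (x := φ l' - Real.pi) (by linarith) (by linarith)
      rwa [Real.sin_sub_pi] at h3) hne'
    rw [Finset.sum_neg_distrib] at this
    linarith
  · push Not at h
    exact Finset.sum_pos (fun l hl => Real.sin_pos_of_pos_of_lt_pi (hT l hl) (h l hl)) hne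

/-- The polygon starting at the origin with sides `v 0, v 1, …`. -/
def polygonOfSides {n : ℕ} (v : Fin n → Plane) : Polygon Plane n :=
  ⟨fun i => ∑ l, if l < i then v l else 0⟩

theorem polygonOfSides_apply {n : ℕ} (v : Fin n → Plane) (i : Fin n) :
    polygonOfSides v i = ∑ l, if l < i then v l else 0 := rfl

theorem polygonOfSides_succ {n : ℕ} {v : Fin n → Plane} (hv : ∑ l, v l = 0) (i : Fin n) :
    polygonOfSides v (finRotate n i) - polygonOfSides v i = v i := by
  obtain ⟨n, rfl⟩ : ∃ m, n = m + 1 := ⟨n - 1, by have := i.pos; omega⟩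
  have hi : v i = ∑ l, if l = i then v l else 0 := by simp
  rw [polygonOfSides_apply, polygonOfSides_apply]
  rcases eq_or_ne i (Fin.last n) with rfl | hne
  -- At the wrap-around, vertex 0 is the empty sum, which equals the full sum because the sides sum
  -- to zero.
  · have h0 : ∑ l, (if l < (0 : Fin (n + 1)) then v l else 0) = ∑ l, v l := by
      rw [hv]; exact Finset.sum_eq_zero fun l _ => by simp
    rw [finRotate_last, h0, ← Finset.sum_sub_distrib, hi]
    refine Finset.sum_congr rfl fun l _ => ?_
    rcases eq_or_ne l (Fin.last n) with rfl | h
    · simp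
    · simp [h, Fin.lt_last_iff_ne_last.mpr h]
  · have hlt : i.val < n := Fin.val_lt_last hne
    rw [← Finset.sum_sub_distrib, hi]
    refine Finset.sum_congr rfl fun l _ => ?_
    have hr : ((finRotate (n + 1) i : Fin (n + 1)) : ℕ) = i + 1 := by
      rw [coe_finRotate_of_ne_last hne]
    have h1 : l < finRotate (n + 1) i ↔ l ≤ i := by
      rw [Fin.lt_def, Fin.le_def, hr]; omega
    rw [if_congr h1 rfl rfl]
    rcases lt_trichotomy l i with h | h | h
    · simp [h, h.le, h.ne]
    · simp [h]
    · simp [h.not_ge, h.not_gt, h.ne']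

/-- Measured from the direction of side i, the other sides have angles in (0, 2π), increasing in
cyclic order. Up to multiples of v i, the vector from vertex i to vertex j is the sum of an initial
block of them, so its height over side i is r² times a partial sum of sines, positive by
`sum_sin_pos`. -/
theorem isConvexPolygon_polygonOfSides {n : ℕ} {r : ℝ} (hr : 0 < r) {θ : Fin n → ℝ}
    (hθ : StrictMono θ) (hlo : ∀ i, -Real.pi < θ i) (hhi : ∀ i, θ i ≤ Real.pi) {v : Fin n → Plane}
    (hv0 : ∀ i, v i 0 = r * Real.cos (θ i)) (hv1 : ∀ i, v i 1 = r * Real.sin (θ i))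
    (hs : ∑ i, v i = 0) : IsConvexPolygon (polygonOfSides v) := by
  intro i
  left
  intro j hji hjr
  rw [polygonOfSides_succ hs]
  have hg : ∀ l, cross (v i) (v l) = r ^ 2 * Real.sin (θ l - θ i) := fun l => by
    rw [cross, hv0, hv1, hv0, hv1, Real.sin_sub]; ring
  let φ : Fin n → ℝ := fun l => if i < l then θ l - θ i else θ l - θ i + 2 * Real.pi
  have hφ : ∀ l, Real.sin (φ l) = Real.sin (θ l - θ i) := fun l => by
    simp only [φ]; split_ifs <;> simp
  have hφ0 : ∀ l, 0 < φ l := fun l => by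
    simp only [φ]; split_ifs with h
    · linarith [hθ h]
    · linarith [hlo l, hhi i]
  have hφ2 : ∀ l, l ≠ i → φ l < 2 * Real.pi := fun l hl => by
    simp only [φ]; split_ifs with h
    · linarith [hlo i, hhi l]
    · linarith [hθ (lt_of_le_of_ne (not_lt.mp h) hl)]
  have hφlt : ∀ l l', l ≠ i → l' ≠ i → (i < l ∧ l' < i ∨ (l < l' ∧ (i < l ↔ i < l'))) →
      φ l < φ l' := fun l l' hl hl' h => by
    simp only [φ]
    rcases h with ⟨h1, h2⟩ | ⟨h1, h2⟩
    · rw [if_pos h1, if_neg h2.not_gt]; linarith [hlo l', hhi l]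
    · by_cases h3 : i < l
      · rw [if_pos h3, if_pos (h2.mp h3)]; linarith [hθ h1]
      · rw [if_neg h3, if_neg (fun h => h3 (h2.mpr h))]; linarith [hθ h1]
  have hself : Real.sin (θ i - θ i) = 0 := by simp
  have htot : ∑ l ∈ Finset.univ.erase i, Real.sin (φ l) = 0 := by
    have h1 : cross (v i) (∑ l, v l) = 0 := by rw [hs]; simp [cross]
    rw [cross_sum_right, ← Finset.add_sum_erase _ _ (Finset.mem_univ i), cross_self, zero_add] at h1
    simp only [hg, ← Finset.mul_sum] at h1
    simp only [hφ]
    exact (mul_eq_zero.mp h1).resolve_left (by positivity)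
  have hcross : cross (v i) (polygonOfSides v j - polygonOfSides v i) =
      r ^ 2 * ∑ l, ((if l < j then Real.sin (θ l - θ i) else 0) -
        (if l < i then Real.sin (θ l - θ i) else 0)) := by
    rw [polygonOfSides_apply, polygonOfSides_apply, ← Finset.sum_sub_distrib, cross_sum_right,
      Finset.mul_sum]
    refine Finset.sum_congr rfl fun l _ => ?_
    have h0 : cross (v i) 0 = 0 := by simp [cross]
    rw [cross_sub_right, mul_sub]
    split_ifs <;> simp [hg, h0]
  rw [hcross]
  refine mul_pos (by positivity) ?_
  rcases lt_or_gt_of_ne hji with hlt | hgt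
  -- For j < i the sides j, …, i - 1 form the final block; the initial block wraps around and is its
  -- complement.
  · let p : Fin n → Prop := fun l => ¬ (j ≤ l ∧ l < i)
    have hT : ∑ l ∈ (Finset.univ.erase i).filter p, Real.sin (φ l) +
        ∑ l ∈ (Finset.univ.erase i).filter (fun l => ¬ p l), Real.sin (φ l) = 0 := by
      rw [Finset.sum_filter_add_sum_filter_not, htot]
    have hpos := sum_sin_pos (fun l _ => hφ0 l) (fun l hl => hφ2 l (by
        simp only [Finset.mem_filter, Finset.mem_erase] at hl; exact hl.1.1))
      (fun l hl l' hl' => by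
        simp only [Finset.mem_filter, Finset.mem_erase, p, Finset.mem_univ, and_true,
          not_not] at hl hl'
        refine hφlt l l' hl.1 hl'.1 ?_
        rcases lt_or_gt_of_ne hl.1 with h | h
        · right
          have h1 : l < j := by
            by_contra h2; exact hl.2 ⟨not_lt.mp h2, h⟩
          exact ⟨h1.trans_le hl'.2.1, ⟨fun h3 => absurd h h3.not_gt,
            fun h3 => absurd hl'.2.2 h3.not_gt⟩⟩
        · exact Or.inl ⟨h, hl'.2.2⟩) ?_ ⟨j, by simp [p, hji, hlt]⟩ hT
    · have : ∑ l, ((if l < j then Real.sin (θ l - θ i) else 0) -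
        (if l < i then Real.sin (θ l - θ i) else 0)) =
          - ∑ l ∈ (Finset.univ.erase i).filter (fun l => ¬ p l), Real.sin (φ l) := by
        rw [Finset.sum_filter, ← Finset.sum_neg_distrib,
          ← Finset.add_sum_erase _ _ (Finset.mem_univ i)]
        simp only [hlt.not_gt, lt_irrefl, if_false, sub_zero, zero_add]
        refine Finset.sum_congr rfl fun l _ => ?_
        simp only [hφ, p, not_not]
        by_cases h1 : l < j
        · simp [h1, h1.not_ge, h1.trans hlt]
        · by_cases h2 : l < i <;> simp [h1, h2, not_lt.mp h1]
      rw [this]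
      linarith
    -- The initial block is empty only if i is the last index and j = 0, and then j is the successor
    -- of i.
    · by_contra hempty
      rw [Finset.not_nonempty_iff_eq_empty, Finset.filter_eq_empty_iff] at hempty
      simp only [Finset.mem_erase, Finset.mem_univ, and_true, p, not_not] at hempty
      obtain ⟨n, rfl⟩ : ∃ m, n = m + 1 := ⟨n - 1, by have := i.pos; omega⟩
      have hi : i = Fin.last n := by
        by_contra hne
        have := (hempty (x := Fin.last n) (Ne.symm hne)).2
        exact absurd (Fin.le_last i) this.not_ge
      have hj : j = 0 := by
        by_contra hne
        have hi0 : (0 : Fin (n + 1)) ≠ i := by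
          rintro rfl; exact absurd hlt (by simp)
        have := (hempty (x := 0) hi0).1
        exact hne (Fin.le_zero_iff.mp this)
      exact hjr (by rw [hi, hj, finRotate_last])
  · let p : Fin n → Prop := fun l => i < l ∧ l < j
    have hT : ∑ l ∈ (Finset.univ.erase i).filter p, Real.sin (φ l) +
        ∑ l ∈ (Finset.univ.erase i).filter (fun l => ¬ p l), Real.sin (φ l) = 0 := by
      rw [Finset.sum_filter_add_sum_filter_not, htot]
    have hpos := sum_sin_pos (fun l _ => hφ0 l) (fun l hl => hφ2 l (by
        simp only [Finset.mem_filter, Finset.mem_erase] at hl; exact hl.1.1))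
      (fun l hl l' hl' => by
        simp only [Finset.mem_filter, Finset.mem_erase, p, Finset.mem_univ, and_true] at hl hl'
        refine hφlt l l' hl.1 hl'.1 ?_
        rcases lt_or_gt_of_ne hl'.1 with h | h
        · exact Or.inl ⟨hl.2.1, h⟩
        · right
          have h1 : j ≤ l' := by
            by_contra h2; exact hl'.2 ⟨h, not_le.mp h2⟩
          exact ⟨hl.2.2.trans_le h1, ⟨fun _ => h, fun _ => hl.2.1⟩⟩) ?_
        ⟨j, by simp [p, hji]⟩ hT
    · have : ∑ l, ((if l < j then Real.sin (θ l - θ i) else 0) -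
        (if l < i then Real.sin (θ l - θ i) else 0)) =
          ∑ l ∈ (Finset.univ.erase i).filter p, Real.sin (φ l) := by
        rw [Finset.sum_filter, ← Finset.add_sum_erase _ _ (Finset.mem_univ i)]
        simp only [lt_irrefl, hself, ite_self, sub_zero, zero_add]
        refine Finset.sum_congr rfl fun l hl => ?_
        have hl : l ≠ i := (Finset.mem_erase.mp hl).1
        simp only [hφ]
        rcases lt_or_gt_of_ne hl with h1 | h1
        · simp [h1, h1.not_gt, h1.trans hgt]
        · simp [h1, h1.not_gt]
      rw [this]
      exact hpos
    · obtain ⟨n, rfl⟩ : ∃ m, n = m + 1 := ⟨n - 1, by have := i.pos; omega⟩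
      have hne : i ≠ Fin.last n := fun h => by
        rw [h] at hgt; exact absurd (Fin.le_last j) hgt.not_ge
      have hr : ((finRotate (n + 1) i : Fin (n + 1)) : ℕ) = i + 1 := by
        rw [coe_finRotate_of_ne_last hne]
      refine ⟨finRotate (n + 1) i, ?_⟩
      have h1 : i < finRotate (n + 1) i := by rw [Fin.lt_def, hr]; omega
      have h2 : finRotate (n + 1) i < j := by
        have h3 : (j : ℕ) ≠ finRotate (n + 1) i := fun h => hjr (Fin.ext h)
        have h4 : (i : ℕ) < j := hgt
        rw [Fin.lt_def]; omega
      exact Finset.mem_filter.mpr ⟨Finset.mem_erase.mpr ⟨h1.ne', Finset.mem_univ _⟩, h1, h2⟩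

theorem sq_norm_eq (v : Plane) : ‖v‖ ^ 2 = v 0 ^ 2 + v 1 ^ 2 := by
  rw [EuclideanSpace.norm_sq_eq]; simp [Fin.sum_univ_two]

/-- Distinct vectors of equal length with vanishing sum are the sides of a convex polygon. -/
theorem exists_convex_of_sides {L : Submodule ℤ Plane} {r : ℝ} (hr : 0 < r) (T : Finset Plane)
    (hT : ∀ v ∈ T, ‖v‖ = r) (hL : ∀ v ∈ T, v ∈ L) (hs : ∑ v ∈ T, v = 0) {n : ℕ}
    (hn : T.card = n) :
    ∃ P : Polygon Plane n, ContainedIn P L ∧ IsEquilateral P ∧ IsConvexPolygon P := by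
  classical
  let α : Plane → ℝ := fun v => Complex.arg ⟨v 0, v 1⟩
  let w : ℝ → Plane := fun t => !₂[r * Real.cos t, r * Real.sin t]
  have hw : ∀ v ∈ T, w (α v) = v := fun v hv => by
    have hnorm : ‖(⟨v 0, v 1⟩ : ℂ)‖ = r := by
      have h1 : ‖(⟨v 0, v 1⟩ : ℂ)‖ ^ 2 = r ^ 2 := by
        rw [← hT v hv, sq_norm_eq, ← Complex.normSq_eq_norm_sq, Complex.normSq_mk]; ring
      exact (sq_eq_sq₀ (norm_nonneg _) hr.le).mp h1
    have h2 := Complex.norm_mul_cos_arg (⟨v 0, v 1⟩ : ℂ)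
    have h3 := Complex.norm_mul_sin_arg (⟨v 0, v 1⟩ : ℂ)
    rw [hnorm] at h2 h3
    ext i
    fin_cases i
    · simpa [w, α] using h2
    · simpa [w, α] using h3
  -- Vectors of one length are determined by their arguments, so sorting the arguments orders the
  -- sides strictly.
  have hinj : Set.InjOn α T := fun u hu v hv h => by rw [← hw u hu, ← hw v hv, h]
  have hcard : (T.image α).card = n := by rw [Finset.card_image_of_injOn hinj, hn]
  let θ := (T.image α).orderEmbOfFin hcard
  have hθ : ∀ i, ∃ u ∈ T, α u = θ i := fun i =>
    Finset.mem_image.mp ((T.image α).orderEmbOfFin_mem hcard i)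
  have hmem : ∀ i, w (θ i) ∈ T := fun i => by
    obtain ⟨u, hu, h⟩ := hθ i
    rw [← h, hw u hu]; exact hu
  have hsum : ∑ i, w (θ i) = 0 := by
    have h1 : ∑ t ∈ T.image α, w t = 0 := by
      rw [Finset.sum_image hinj, ← hs]
      exact Finset.sum_congr rfl hw
    rw [← h1, ← Finset.map_orderEmbOfFin_univ (T.image α) hcard, Finset.sum_map]
    rfl
  refine ⟨polygonOfSides fun i => w (θ i), fun i => ?_, ⟨r, hr, fun i => ?_⟩,
    isConvexPolygon_polygonOfSides hr θ.strictMono (fun i => ?_) (fun i => ?_) (fun i => ?_)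
      (fun i => ?_) hsum⟩
  · rw [polygonOfSides_apply]
    refine Submodule.sum_mem _ fun l _ => ?_
    split_ifs
    · exact hL _ (hmem l)
    · exact zero_mem _
  · rw [dist_comm, dist_eq_norm, polygonOfSides_succ hsum]
    exact hT _ (hmem i)
  · obtain ⟨u, -, h⟩ := hθ i
    rw [← h]; exact Complex.neg_pi_lt_arg _
  · obtain ⟨u, -, h⟩ := hθ i
    rw [← h]; exact Complex.arg_le_pi _
  · simp [w]
  · simp [w]

/-! ### Convex polygons are simple -/

theorem IsConvexPolygon.cross_ne_zero {n : ℕ} {P : Polygon Plane n} (h : IsConvexPolygon P)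
    {i j : Fin n} (h1 : j ≠ i) (h2 : j ≠ finRotate n i) :
    cross (P (finRotate n i) - P i) (P j - P i) ≠ 0 := by
  rcases h i with h | h
  · exact (h j h1 h2).ne'
  · exact (h j h1 h2).ne

theorem finRotate_ne_self {n : ℕ} (hn : 2 ≤ n) (i : Fin n) : finRotate n i ≠ i := by
  obtain ⟨m, rfl⟩ : ∃ m, n = m + 2 := ⟨n - 2, by omega⟩
  rw [finRotate_apply]
  simp

theorem finRotate_finRotate_ne_self {n : ℕ} (hn : 3 ≤ n) (i : Fin n) :
    finRotate n (finRotate n i) ≠ i := by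
  obtain ⟨m, rfl⟩ : ∃ m, n = m + 3 := ⟨n - 3, by omega⟩
  rw [finRotate_apply, finRotate_apply, add_assoc, ne_eq, add_eq_left, Fin.ext_iff,
    Fin.val_add]
  simp [Nat.mod_eq_of_lt (show 2 < m + 2 + 1 by omega)]

theorem cross_lineMap_sub (u p q o : Plane) (t : ℝ) :
    cross u (AffineMap.lineMap p q t - o) =
      (1 - t) * cross u (p - o) + t * cross u (q - o) := by
  simp [cross, AffineMap.lineMap_apply]; ring

/-- The signed height over the line of side i is affine along side j. It has one strict sign at the
end points of side j that are not on side i, so it vanishes at most at a shared vertex. -/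
theorem IsConvexPolygon.mem_of_mem_edgeSet {n : ℕ} (hn : 3 ≤ n) {P : Polygon Plane n}
    (h : IsConvexPolygon P) {i j : Fin n} (hij : i ≠ j) {x : Plane} (hi : x ∈ P.edgeSet ℝ i)
    (hj : x ∈ P.edgeSet ℝ j) : x ∈ ({P j, P (finRotate n j)} : Set Plane) := by
  rw [Polygon.edgeSet_eq_image_edgePath] at hi hj
  obtain ⟨s, ⟨-, -⟩, rfl⟩ := hi
  obtain ⟨t, ⟨ht0, ht1⟩, ht⟩ := hj
  have ht' : AffineMap.lineMap (P j) (P (finRotate n j)) t =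
    AffineMap.lineMap (P i) (P (finRotate n i)) s := ht
  have h0 : cross (P (finRotate n i) - P i)
      (AffineMap.lineMap (P i) (P (finRotate n i)) s - P i) = 0 := by
    rw [cross_lineMap_sub, cross_self, sub_self]; simp [cross]
  rw [← ht', cross_lineMap_sub] at h0
  rw [← ht]
  change AffineMap.lineMap (P j) (P (finRotate n j)) t ∈ _
  have hs : finRotate n j ≠ finRotate n i := fun h => hij ((finRotate n).injective h).symm
  by_cases h1 : j = finRotate n i
  · have h2 : finRotate n j ≠ i := by rw [h1]; exact finRotate_finRotate_ne_self hn i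
    have h3 := h.cross_ne_zero h2 hs
    have h5 : cross (P (finRotate n i) - P i) (P j - P i) = 0 := by rw [h1, cross_self]
    rw [h5, mul_zero, zero_add] at h0
    have h4 : t = 0 := (mul_eq_zero.mp h0).resolve_right h3
    left
    rw [h4, AffineMap.lineMap_apply_zero]
  · by_cases h2 : finRotate n j = i
    · have h3 := h.cross_ne_zero hij.symm h1
      have h5 : cross (P (finRotate n i) - P i) (P (finRotate n j) - P i) = 0 := by
        rw [h2, sub_self]; simp [cross]
      rw [h5, mul_zero, add_zero] at h0
      have h4 : t = 1 := by linarith [(mul_eq_zero.mp h0).resolve_right h3]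
      right
      rw [h4, AffineMap.lineMap_apply_one]
      rfl
    · exfalso
      rcases h i with h | h
      · have a := h j hij.symm h1
        have b := h _ h2 hs
        rcases eq_or_lt_of_le ht0 with h6 | h6
        · rw [← h6] at h0; linarith
        · nlinarith [mul_pos h6 b, mul_nonneg (sub_nonneg.mpr ht1) a.le]
      · have a := h j hij.symm h1
        have b := h _ h2 hs
        rcases eq_or_lt_of_le ht0 with h6 | h6
        · rw [← h6] at h0; linarith
        · nlinarith [mul_pos_of_neg_of_neg (neg_neg_of_pos h6) b,
            mul_nonneg_of_nonpos_of_nonpos (sub_nonpos.mpr ht1) a.le]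

theorem IsConvexPolygon.isSimple {n : ℕ} (hn : 3 ≤ n) {P : Polygon Plane n}
    (h : IsConvexPolygon P) : IsSimple P := by
  refine ⟨fun i j hPij => ?_, fun i j hij x hx => ⟨?_, ?_⟩⟩
  · by_contra hij
    by_cases hj : j = finRotate n i
    · have h1 : finRotate n j ≠ i := by rw [hj]; exact finRotate_finRotate_ne_self hn i
      have h2 : finRotate n j ≠ finRotate n i := by
        rw [← hj]; exact finRotate_ne_self (by omega) j
      apply h.cross_ne_zero h1 h2
      rw [← hj, show P j = P i from hPij.symm, sub_self]
      simp [cross]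
    · apply h.cross_ne_zero (Ne.symm hij) hj
      rw [show P j = P i from hPij.symm, sub_self]
      simp [cross]
  · exact h.mem_of_mem_edgeSet hn hij.symm hx.2 hx.1
  · exact h.mem_of_mem_edgeSet hn hij hx.1 hx.2

/-! ### Gram matrices -/

theorem inner_eq (u v : Plane) : inner ℝ u v = u 0 * v 0 + u 1 * v 1 := by
  simp only [PiLp.inner_apply, Fin.sum_univ_two, RCLike.inner_apply, conj_trivial]
  ring

/-- Lagrange's identity; for vectors of equal length it becomes the norm equation X² + mY² = N². -/
theorem cross_sq_add_inner_sq (u v : Plane) :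
    cross u v ^ 2 + (inner ℝ u v : ℝ) ^ 2 = inner ℝ u u * inner ℝ v v := by
  simp only [inner_eq, cross]; ring

theorem inner_add_smul (a b : Plane) (x y x' y' : ℝ) :
    inner ℝ (x • a + y • b) (x' • a + y' • b) =
      x * x' * inner ℝ a a + (x * y' + y * x') * inner ℝ a b + y * y' * inner ℝ b b := by
  simp only [inner_eq, PiLp.add_apply, PiLp.smul_apply, smul_eq_mul]; ring

theorem cross_add_smul (a b : Plane) (x y x' y' : ℝ) :
    cross (x • a + y • b) (x' • a + y' • b) = (x * y' - y * x') * cross a b := by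
  simp [cross]; ring

theorem cross_ne_zero_of_linearIndependent {a b : Plane} (h : LinearIndependent ℝ ![a, b]) :
    cross a b ≠ 0 := by
  rw [LinearIndependent.pair_iff] at h
  intro h0
  have h0 : a 0 * b 1 - a 1 * b 0 = 0 := h0
  have e1 := h (b 1) (-(a 1)) (by ext i; fin_cases i <;> simp <;> linarith)
  have e2 := h (b 0) (-(a 0)) (by ext i; fin_cases i <;> simp <;> linarith)
  have e3 := h 1 0 (by
    ext i; fin_cases i <;> simp
    · linarith [e2.2]
    · linarith [e1.2])
  exact one_ne_zero e3.1

theorem linearIndependent_of_cross_ne_zero {a b : Plane} (h : cross a b ≠ 0) :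
    LinearIndependent ℝ ![a, b] := by
  rw [LinearIndependent.pair_iff]
  intro s t hst
  have h1 : cross (s • a + t • b) ((0 : ℝ) • a + (1 : ℝ) • b) = 0 := by rw [hst]; simp [cross]
  have h2 : cross (s • a + t • b) ((1 : ℝ) • a + (0 : ℝ) • b) = 0 := by rw [hst]; simp [cross]
  rw [cross_add_smul] at h1 h2
  have h1 := (mul_eq_zero.mp h1).resolve_right h
  have h2 := (mul_eq_zero.mp h2).resolve_right h
  constructor <;> linarith

theorem mem_span_pair_iff {a b v : Plane} :
    v ∈ Submodule.span ℤ {a, b} ↔ ∃ p q : ℤ, v = (p : ℝ) • a + (q : ℝ) • b := by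
  rw [Submodule.mem_span_pair]
  simp only [Int.cast_smul_eq_zsmul, eq_comm]

/-! ### From the Gram matrix to convex polygons -/

theorem exists_common_denominator (S : Finset (ℚ × ℚ)) :
    ∃ D : ℕ, 0 < D ∧ ∀ v ∈ S, ∃ X Y : ℤ, D * v.1 = X ∧ D * v.2 = Y := by
  classical
  induction S using Finset.induction_on with
  | empty => exact ⟨1, one_pos, by simp⟩
  | insert v S hv ih =>
    obtain ⟨D, hD, h⟩ := ih
    refine ⟨D * (v.1.den * v.2.den), by have := v.1.den_pos; have := v.2.den_pos; positivity, ?_⟩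
    intro w hw
    rcases Finset.mem_insert.mp hw with rfl | hw
    · refine ⟨D * w.2.den * w.1.num, D * w.1.den * w.2.num, ?_, ?_⟩
      · push_cast; rw [← Rat.mul_den_eq_num w.1]; ring
      · push_cast; rw [← Rat.mul_den_eq_num w.2]; ring
    · obtain ⟨X, Y, hX, hY⟩ := h w hw
      refine ⟨X * (v.1.den * v.2.den), Y * (v.1.den * v.2.den), ?_, ?_⟩
      · push_cast; rw [← hX]; ring
      · push_cast; rw [← hY]; ring

/-- Completing the square, A(Ap² + 2Bpq + Cq²) = (Ap + Bq)² + t²mq². With p = xt - yB and q = yA the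
form takes the value At²(x² + my²), so norm-one elements go to vectors of equal length. The factor D
clears denominators. -/
theorem exists_convex_of_isUnitCycle {a b : Plane} (hab : LinearIndependent ℝ ![a, b]) {c : ℝ}
    (hc : 0 < c) {A B C t : ℤ} {m : ℕ} (hA : c * inner ℝ a a = A) (hB : c * inner ℝ a b = B)
    (hC : c * inner ℝ b b = C) (hm : A * C - B ^ 2 = t ^ 2 * m) {S : Finset (ℚ × ℚ)}
    (hS : IsUnitCycle m S) {k : ℕ} (hk : S.card = k) :
    ∃ P : Polygon Plane k, ContainedIn P (Submodule.span ℤ {a, b}) ∧ IsEquilateral P ∧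
      IsConvexPolygon P := by
  classical
  have hcr := cross_ne_zero_of_linearIndependent hab
  have hgram : c ^ 2 * cross a b ^ 2 = A * C - B ^ 2 := by
    rw [← hA, ← hB, ← hC]
    linear_combination c ^ 2 * cross_sq_add_inner_sq a b
  have ht : t ≠ 0 := by
    rintro rfl
    have h1 : (A * C - B ^ 2 : ℝ) = 0 := by
      have : A * C - B ^ 2 = 0 := by rw [hm]; ring
      exact_mod_cast this
    rw [h1] at hgram
    have : c ^ 2 * cross a b ^ 2 ≠ 0 := by positivity
    exact this hgram
  have ha : 0 < (inner ℝ a a : ℝ) := by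
    have : a ≠ 0 := by
      rintro rfl; exact hcr (by simp [cross])
    exact real_inner_self_pos.mpr this
  have hA0 : A ≠ 0 := by
    rintro rfl
    have := mul_pos hc ha
    rw [hA] at this
    simp at this
  obtain ⟨D, hD, hDS⟩ := exists_common_denominator S
  let g : ℚ × ℚ →+ Plane :=
    { toFun := fun v => ((D * (v.1 * t - v.2 * B) : ℚ) : ℝ) • a + ((D * v.2 * A : ℚ) : ℝ) • b
      map_zero' := by simp
      map_add' := fun v w => by
        have e1 : (D * ((v + w).1 * t - (v + w).2 * B) : ℚ) =
          D * (v.1 * t - v.2 * B) + D * (w.1 * t - w.2 * B) := by simp; ring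
        have e2 : (D * (v + w).2 * A : ℚ) = D * v.2 * A + D * w.2 * A := by simp; ring
        rw [e1, e2, Rat.cast_add, Rat.cast_add, add_smul, add_smul]
        abel }
  have hg : ∀ v, g v = ((D * (v.1 * t - v.2 * B) : ℚ) : ℝ) • a + ((D * v.2 * A : ℚ) : ℝ) • b :=
    fun _ => rfl
  have hinj : Function.Injective g := by
    rw [injective_iff_map_eq_zero]
    intro v hv
    rw [hg] at hv
    obtain ⟨h1, h2⟩ := LinearIndependent.pair_iff.mp hab _ _ hv
    have h1 : (D * (v.1 * t - v.2 * B) : ℚ) = 0 := by exact_mod_cast h1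
    have h2 : (D * v.2 * A : ℚ) = 0 := by exact_mod_cast h2
    have hD' : (D : ℚ) ≠ 0 := by positivity
    have hA' : (A : ℚ) ≠ 0 := by exact_mod_cast hA0
    have ht' : (t : ℚ) ≠ 0 := by exact_mod_cast ht
    have h3 : v.2 = 0 := by simpa [hD', hA'] using h2
    have h4 : v.1 = 0 := by simpa [hD', ht', h3] using h1
    exact Prod.ext h4 h3
  have hnorm : ∀ v ∈ S, ‖g v‖ = D * |(t : ℝ)| * ‖a‖ := by
    intro v hv
    have h1 := hS.1 v hv
    have h1 : (v.1 : ℝ) ^ 2 + m * (v.2 : ℝ) ^ 2 = 1 := by exact_mod_cast h1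
    have hm' : (A * C - B ^ 2 : ℝ) = t ^ 2 * m := by exact_mod_cast hm
    rw [← sq_eq_sq₀ (norm_nonneg _) (by positivity), mul_pow, mul_pow, sq_abs,
      ← real_inner_self_eq_norm_sq, ← real_inner_self_eq_norm_sq, hg, inner_add_smul]
    apply mul_left_cancel₀ hc.ne'
    push_cast
    linear_combination (D * (v.1 * t - v.2 * B) : ℝ) ^ 2 * hA +
      2 * (D * (v.1 * t - v.2 * B) : ℝ) * (D * v.2 * A) * hB + (D * v.2 * A : ℝ) ^ 2 * hC +
      (D : ℝ) ^ 2 * v.2 ^ 2 * A * hm' + (D : ℝ) ^ 2 * t ^ 2 * A * h1 - (D : ℝ) ^ 2 * t ^ 2 * hA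
  refine exists_convex_of_sides (r := D * |(t : ℝ)| * ‖a‖) ?_ (S.image g) ?_ ?_ ?_ ?_
  · have : 0 < ‖a‖ := norm_pos_iff.mpr fun h => by rw [h] at ha; simp at ha
    have : 0 < |(t : ℝ)| := abs_pos.mpr (by exact_mod_cast ht)
    positivity
  · exact Finset.forall_mem_image.mpr hnorm
  · rw [Finset.forall_mem_image]
    intro v hv
    obtain ⟨X, Y, hX, hY⟩ := hDS v hv
    refine mem_span_pair_iff.mpr ⟨X * t - Y * B, Y * A, ?_⟩
    have e1 : (D * (v.1 * t - v.2 * B) : ℚ) = ((X * t - Y * B : ℤ) : ℚ) := by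
      push_cast; rw [← hX, ← hY]; ring
    have e2 : (D * v.2 * A : ℚ) = ((Y * A : ℤ) : ℚ) := by
      push_cast; rw [← hY]
    rw [hg, e1, e2, Rat.cast_intCast, Rat.cast_intCast]
  · rw [Finset.sum_image hinj.injOn, ← map_sum, hS.2, map_zero]
  · rw [Finset.card_image_of_injective _ hinj, hk]

/-- A lattice similar to an integral lattice `L'` has, up to scaling, an integral Gram matrix
whose determinant is `ν(L')` times a square. -/
theorem exists_gram_of_isSimilar {a b : Plane} {L' : Submodule ℤ Plane} (hL' : IsPlanarLattice L')
    (hI : IsIntegral L') (hsim : IsSimilar (Submodule.span ℤ {a, b}) L') :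
    ∃ (c : ℝ) (A B C t : ℤ), 0 < c ∧ c * inner ℝ a a = A ∧ c * inner ℝ a b = B ∧
      c * inner ℝ b b = C ∧ A * C - B ^ 2 = t ^ 2 * nu L' := by
  obtain ⟨-, k, hk⟩ := nu_spec L' hL' hI
  obtain ⟨e, f, hef, rfl⟩ := hL'
  rw [area_span e f hef, sq_abs] at hk
  obtain ⟨c, hc, g, hg⟩ := hsim
  have hmem : ∀ x ∈ Submodule.span ℤ {a, b}, g (c • x) ∈ Submodule.span ℤ {e, f} := fun x hx => by
    have : g (c • x) ∈ (fun x : Plane => g (c • x)) '' (Submodule.span ℤ {a, b} : Set Plane) :=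
      ⟨x, hx, rfl⟩
    rw [hg] at this
    exact this
  have ha : a ∈ Submodule.span ℤ {a, b} := Submodule.subset_span (by simp)
  have hb : b ∈ Submodule.span ℤ {a, b} := Submodule.subset_span (by simp)
  have ha' := Submodule.sub_mem _ (hmem a ha) (hmem 0 (zero_mem _))
  have hb' := Submodule.sub_mem _ (hmem b hb) (hmem 0 (zero_mem _))
  -- The isometry need not fix the origin; differences remove the translation. Polarization then
  -- transfers inner products from norms.
  set a' := g (c • a) - g (c • 0) with ha'_def
  set b' := g (c • b) - g (c • 0) with hb'_def
  have na : ‖a'‖ = c * ‖a‖ := by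
    rw [ha'_def, ← dist_eq_norm, g.isometry.dist_eq, dist_eq_norm, ← smul_sub, sub_zero, norm_smul,
      Real.norm_of_nonneg hc.le]
  have nb : ‖b'‖ = c * ‖b‖ := by
    rw [hb'_def, ← dist_eq_norm, g.isometry.dist_eq, dist_eq_norm, ← smul_sub, sub_zero, norm_smul,
      Real.norm_of_nonneg hc.le]
  have nab : ‖a' - b'‖ = c * ‖a - b‖ := by
    rw [ha'_def, hb'_def, sub_sub_sub_cancel_right, ← dist_eq_norm, g.isometry.dist_eq,
      dist_eq_norm, ← smul_sub, norm_smul, Real.norm_of_nonneg hc.le]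
  have iaa : (inner ℝ a' a' : ℝ) = c ^ 2 * inner ℝ a a := by
    rw [real_inner_self_eq_norm_sq, real_inner_self_eq_norm_sq, na]; ring
  have ibb : (inner ℝ b' b' : ℝ) = c ^ 2 * inner ℝ b b := by
    rw [real_inner_self_eq_norm_sq, real_inner_self_eq_norm_sq, nb]; ring
  have iab : (inner ℝ a' b' : ℝ) = c ^ 2 * inner ℝ a b := by
    rw [real_inner_eq_norm_mul_self_add_norm_mul_self_sub_norm_sub_mul_self_div_two,
      real_inner_eq_norm_mul_self_add_norm_mul_self_sub_norm_sub_mul_self_div_two, na, nb, nab]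
    ring
  obtain ⟨A, hA⟩ := hI _ ha' _ ha'
  obtain ⟨B, hB⟩ := hI _ ha' _ hb'
  obtain ⟨C, hC⟩ := hI _ hb' _ hb'
  obtain ⟨p, q, hpq⟩ := mem_span_pair_iff.mp ha'
  obtain ⟨p', q', hpq'⟩ := mem_span_pair_iff.mp hb'
  -- t is the determinant of a', b' in the basis e, f, times the k with D(L')² = k²ν(L').
  refine ⟨c ^ 2, A, B, C, (p * q' - q * p') * k, by positivity, by rw [← iaa, hA],
    by rw [← iab, hB], by rw [← ibb, hC], ?_⟩
  have h1 := cross_sq_add_inner_sq a' b'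
  have h2 : cross a' b' = (p * q' - q * p') * cross e f := by rw [hpq, hpq', cross_add_smul]
  rw [hA, hB, hC, h2] at h1
  have h3 : (A * C - B ^ 2 : ℝ) = ((p * q' - q * p') * k) ^ 2 *
      (nu (Submodule.span ℤ {e, f}) : ℝ) := by
    linear_combination -h1 + (p * q' - q * p' : ℝ) ^ 2 * hk
  exact_mod_cast h3

/-! ### From equilateral polygons to integral lattices -/

/-- Parallel vectors of equal length agree up to sign. -/
theorem eq_or_eq_neg_of_cross_eq_zero {u v : Plane} (h : cross u v = 0)
    (hn : (inner ℝ u u : ℝ) = inner ℝ v v) : v = u ∨ v = -u := by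
  have h1 := cross_sq_add_inner_sq u v
  have h2 : ((inner ℝ u v : ℝ) - inner ℝ u u) * (inner ℝ u v + inner ℝ u u) = 0 := by
    rw [h, ← hn] at h1; linear_combination h1
  rcases mul_eq_zero.mp h2 with h3 | h3
  · left
    have : (inner ℝ (v - u) (v - u) : ℝ) = 0 := by
      rw [inner_sub_sub_self, real_inner_comm]
      simp only [real_inner_comm] at h3 hn ⊢
      linarith
    exact sub_eq_zero.mp (inner_self_eq_zero.mp this)
  · right
    have : (inner ℝ (v + u) (v + u) : ℝ) = 0 := by
      rw [inner_add_add_self, real_inner_comm]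
      simp only [real_inner_comm] at h3 hn ⊢
      linarith
    exact eq_neg_of_add_eq_zero_left (inner_self_eq_zero.mp this)

/-- An odd number of vectors `± u`, `± w` with `u`, `w` linearly independent do not sum to zero. -/
theorem sum_ne_zero_of_eq_or_neg {ι : Type*} [Fintype ι] (hn : Odd (Fintype.card ι)) {u w : Plane}
    (huw : LinearIndependent ℝ ![u, w]) {v : ι → Plane}
    (hv : ∀ i, (v i = u ∨ v i = -u) ∨ (v i = w ∨ v i = -w)) : ∑ i, v i ≠ 0 := by
  have key : ∀ i, ∃ x y : ℤ, v i = (x : ℝ) • u + (y : ℝ) • w ∧ Odd (x + y) := by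
    intro i
    rcases hv i with (h | h) | (h | h)
    · exact ⟨1, 0, by simp [h], by decide⟩
    · exact ⟨-1, 0, by simp [h], by decide⟩
    · exact ⟨0, 1, by simp [h], by decide⟩
    · exact ⟨0, -1, by simp [h], by decide⟩
  choose x y hxy ho using key
  intro hs
  simp only [hxy, Finset.sum_add_distrib, ← Finset.sum_smul] at hs
  obtain ⟨h1, h2⟩ := LinearIndependent.pair_iff.mp huw _ _ hs
  have h1 : ∑ i, x i = 0 := by exact_mod_cast h1
  have h2 : ∑ i, y i = 0 := by exact_mod_cast h2
  have := odd_sum_of_odd hn ho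
  rw [Finset.sum_add_distrib, h1, h2] at this
  exact absurd this (by decide)

theorem exists_linearIndependent_right {u : Plane} (hu : u ≠ 0) :
    ∃ w : Plane, LinearIndependent ℝ ![u, w] := by
  refine ⟨!₂[-u 1, u 0], linearIndependent_of_cross_ne_zero fun h => hu ?_⟩
  have h : u 0 ^ 2 + u 1 ^ 2 = 0 := by
    simp [cross] at h; linarith
  have h0 : u 0 = 0 := by nlinarith [sq_nonneg (u 0), sq_nonneg (u 1)]
  have h1 : u 1 = 0 := by nlinarith [sq_nonneg (u 0), sq_nonneg (u 1)]
  ext i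
  fin_cases i
  · exact h0
  · exact h1

/-- If an odd number of vectors of equal length in a lattice have vanishing sum, then the Gram
matrix of the lattice is integral up to scaling. -/
theorem exists_gram_of_sum_eq_zero {ι : Type*} [Fintype ι] (hn : Odd (Fintype.card ι))
    {a b : Plane} (hab : LinearIndependent ℝ ![a, b]) {R : ℝ} (hR : 0 < R) {v : ι → Plane}
    (hv : ∀ i, v i ∈ Submodule.span ℤ {a, b}) (hvR : ∀ i, (inner ℝ (v i) (v i) : ℝ) = R)
    (hs : ∑ i, v i = 0) :
    ∃ (c : ℝ) (A B C : ℤ), 0 < c ∧ c * inner ℝ a a = A ∧ c * inner ℝ a b = B ∧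
      c * inner ℝ b b = C := by
  have hne : Nonempty ι := Fintype.card_pos_iff.mp hn.pos
  obtain ⟨i⟩ := hne
  have hcr := cross_ne_zero_of_linearIndependent hab
  choose p q hpq using fun k => mem_span_pair_iff.mp (hv k)
  have hcross : ∀ k l, cross (v k) (v l) = (p k * q l - q k * p l) * cross a b := fun k l => by
    rw [hpq k, hpq l, cross_add_smul]
  have hvi : v i ≠ 0 := fun h => by
    have := hvR i
    rw [h, inner_zero_left] at this
    exact hR.ne this
  obtain ⟨j, hj⟩ : ∃ j, cross (v i) (v j) ≠ 0 := by
    by_contra! h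
    obtain ⟨w, hw⟩ := exists_linearIndependent_right hvi
    exact sum_ne_zero_of_eq_or_neg hn hw
      (fun k => Or.inl (eq_or_eq_neg_of_cross_eq_zero (h k) (by rw [hvR, hvR]))) hs
  -- Otherwise every vector is ± v i or ± v j, which parity excludes.
  obtain ⟨k, hk1, hk2⟩ : ∃ k, cross (v i) (v k) ≠ 0 ∧ cross (v j) (v k) ≠ 0 := by
    by_contra! h
    refine sum_ne_zero_of_eq_or_neg hn (linearIndependent_of_cross_ne_zero hj) (fun k => ?_) hs
    by_cases hk : cross (v i) (v k) = 0
    · exact Or.inl (eq_or_eq_neg_of_cross_eq_zero hk (by rw [hvR, hvR]))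
    · exact Or.inr (eq_or_eq_neg_of_cross_eq_zero (h k hk) (by rw [hvR, hvR]))
  rw [hcross] at hj hk1 hk2
  -- Cramer's rule: d v k = x v i + y v j with all three coefficients nonzero.
  set d : ℤ := p i * q j - q i * p j with hd
  set x : ℤ := p k * q j - q k * p j with hx
  set y : ℤ := p i * q k - q i * p k with hy
  have hd0 : d ≠ 0 := fun h => hj (by
    have : (p i * q j - q i * p j : ℝ) = (d : ℝ) := by rw [hd]; push_cast; ring
    rw [this, h]; simp)
  have hy0 : y ≠ 0 := fun h => hk1 (by
    have : (p i * q k - q i * p k : ℝ) = (y : ℝ) := by rw [hy]; push_cast; ring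
    rw [this, h]; simp)
  have hx0 : x ≠ 0 := fun h => hk2 (by
    have : (p j * q k - q j * p k : ℝ) = -(x : ℝ) := by rw [hx]; push_cast; ring
    rw [this, h]; simp)
  set E : ℝ := inner ℝ a a with hE
  set F : ℝ := inner ℝ a b with hF
  set G : ℝ := inner ℝ b b with hG
  have hQ : ∀ l, (p l : ℝ) * p l * E + (p l * q l + q l * p l) * F + q l * q l * G = R := fun l => by
    rw [← hvR l, hpq l, inner_add_smul]
  set I : ℝ := p i * p j * E + (p i * q j + q i * p j) * F + q i * q j * G with hI
  have hdr : (d : ℝ) = p i * q j - q i * p j := by rw [hd]; push_cast; ring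
  have hxr : (x : ℝ) = p k * q j - q k * p j := by rw [hx]; push_cast; ring
  have hyr : (y : ℝ) = p i * q k - q i * p k := by rw [hy]; push_cast; ring
  have hpk : (d : ℝ) * p k = x * p i + y * p j := by rw [hdr, hxr, hyr]; ring
  have hqk : (d : ℝ) * q k = x * q i + y * q j := by rw [hdr, hxr, hyr]; ring
  -- Comparing squared lengths in Cramer's relation makes the inner product I of v i and v j a
  -- rational multiple of R.
  have hrat : 2 * x * y * I = (d ^ 2 - x ^ 2 - y ^ 2) * R := by
    have h1 : (d : ℝ) ^ 2 * R = (d * p k) * (d * p k) * E +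
        ((d * p k) * (d * q k) + (d * q k) * (d * p k)) * F + (d * q k) * (d * q k) * G := by
      rw [← hQ k]; ring
    rw [hpk, hqk] at h1
    rw [hI]
    linear_combination -h1 - (x : ℝ) ^ 2 * hQ i - (y : ℝ) ^ 2 * hQ j
  have hx' : (x : ℝ) ≠ 0 := by exact_mod_cast hx0
  have hy' : (y : ℝ) ≠ 0 := by exact_mod_cast hy0
  have hd' : (d : ℝ) ≠ 0 := by exact_mod_cast hd0
  set M : ℤ := 2 * x * y with hM
  set s : ℤ := d ^ 2 - x ^ 2 - y ^ 2 with hs'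
  have hMI : (M : ℝ) * I = s * R := by
    rw [hM, hs']; push_cast; exact hrat
  have hM0 : (M : ℝ) ≠ 0 := by rw [hM]; push_cast; positivity
  -- Since d a = q j v i - q i v j and d b = p i v j - p j v i, the entries d²E, d²F, d²G are
  -- integral combinations of R and I; the factor M²/R makes them integers through M I = s R.
  refine ⟨(M * d) ^ 2 / R, M * (M * (q j ^ 2 + q i ^ 2) - 2 * q i * q j * s),
    M * (-M * (p j * q j + p i * q i) + (q j * p i + q i * p j) * s),
    M * (M * (p j ^ 2 + p i ^ 2) - 2 * p i * p j * s), by positivity, ?_, ?_, ?_⟩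
  · have h1 : (d : ℝ) ^ 2 * E = (q j ^ 2 + q i ^ 2) * R - 2 * q i * q j * I := by
      rw [hI, hdr]
      linear_combination (q j : ℝ) ^ 2 * hQ i + (q i : ℝ) ^ 2 * hQ j
    push_cast
    field_simp
    linear_combination (M : ℝ) * h1 - 2 * q i * q j * hMI
  · have h1 : (d : ℝ) ^ 2 * F = -(p j * q j + p i * q i) * R + (q j * p i + q i * p j) * I := by
      rw [hI, hdr]
      linear_combination -(p j * q j : ℝ) * hQ i - (p i * q i : ℝ) * hQ j
    push_cast
    field_simp
    linear_combination (M : ℝ) * h1 + (q j * p i + q i * p j : ℝ) * hMI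
  · have h1 : (d : ℝ) ^ 2 * G = (p j ^ 2 + p i ^ 2) * R - 2 * p i * p j * I := by
      rw [hI, hdr]
      linear_combination (p j : ℝ) ^ 2 * hQ i + (p i : ℝ) ^ 2 * hQ j
    push_cast
    field_simp
    linear_combination (M : ℝ) * h1 - 2 * p i * p j * hMI

/-- The square-free part attached to an integral lattice containing an odd number of vectors of
equal length with vanishing sum. -/
theorem nu_of_sum_eq_zero {ι : Type*} [Fintype ι] (hn : Odd (Fintype.card ι)) {a b : Plane}
    (hab : LinearIndependent ℝ ![a, b]) (hI : IsIntegral (Submodule.span ℤ {a, b})) {R : ℝ}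
    (hR : 0 < R) {v : ι → Plane} (hv : ∀ i, v i ∈ Submodule.span ℤ {a, b})
    (hvR : ∀ i, (inner ℝ (v i) (v i) : ℝ) = R) (hs : ∑ i, v i = 0) :
    nu (Submodule.span ℤ {a, b}) % 4 = 3 ∧
      ∀ p : ℕ, p.Prime → p ∣ nu (Submodule.span ℤ {a, b}) → p ≤ Fintype.card ι := by
  obtain ⟨hm, k, hk⟩ := nu_spec _ ⟨a, b, hab, rfl⟩ hI
  set m := nu (Submodule.span ℤ {a, b})
  rw [area_span a b hab, sq_abs] at hk
  have hne : Nonempty ι := Fintype.card_pos_iff.mp hn.pos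
  obtain ⟨i⟩ := hne
  choose p q hpq using fun k => mem_span_pair_iff.mp (hv k)
  choose X hX using fun j => hI _ (hv i) _ (hv j)
  -- With the plane read as ℂ, X j + Y j √-m is conj(v i) · v j up to the sign of the imaginary
  -- part, since det(a, b)² = k²m. The common N is X i = R.
  let Y : ι → ℤ := fun j => k * (p i * q j - q i * p j)
  have hN : X i ≠ 0 := fun h => by
    have := hX i
    rw [h, hvR, Int.cast_zero] at this
    exact hR.ne' this
  have hXR : (X i : ℝ) = R := by rw [← hX, hvR]
  have hXY : ∀ j, X j ^ 2 + (m : ℤ) * Y j ^ 2 = X i ^ 2 := fun j => by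
    have h1 := cross_sq_add_inner_sq (v i) (v j)
    have h2 : cross (v i) (v j) = (p i * q j - q i * p j) * cross a b := by
      rw [hpq i, hpq j, cross_add_smul]
    rw [hX, hvR, hvR, h2, ← hXR] at h1
    have h3 : (X j : ℝ) ^ 2 + m * (k * (p i * q j - q i * p j)) ^ 2 = X i ^ 2 := by
      linear_combination h1 - (p i * q j - q i * p j : ℝ) ^ 2 * hk
    exact_mod_cast h3
  have hXs : ∑ j, X j = 0 := by
    have : (∑ j, (X j : ℝ)) = 0 := by
      simp only [← hX, ← inner_sum, hs, inner_zero_right]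
    exact_mod_cast this
  have hpqs : ∑ j, p j = 0 ∧ ∑ j, q j = 0 := by
    simp only [hpq, Finset.sum_add_distrib, ← Finset.sum_smul] at hs
    obtain ⟨h1, h2⟩ := LinearIndependent.pair_iff.mp hab _ _ hs
    exact ⟨by exact_mod_cast h1, by exact_mod_cast h2⟩
  have hYs : ∑ j, Y j = 0 := by
    simp only [Y, ← Finset.mul_sum, Finset.sum_sub_distrib, hpqs.1, hpqs.2]
    simp
  exact ⟨mod_four_eq_three hn hm hN hXY hXs hYs,
    fun r hr hrm => prime_le_card hn hm hN hXY hXs hYs hr hrm⟩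

theorem isIntegral_span_pair {a b : Plane} {A B C : ℤ} (hA : (inner ℝ a a : ℝ) = A)
    (hB : (inner ℝ a b : ℝ) = B) (hC : (inner ℝ b b : ℝ) = C) :
    IsIntegral (Submodule.span ℤ {a, b}) := by
  intro x hx y hy
  obtain ⟨p, q, rfl⟩ := mem_span_pair_iff.mp hx
  obtain ⟨p', q', rfl⟩ := mem_span_pair_iff.mp hy
  refine ⟨p * p' * A + (p * q' + q * p') * B + q * q' * C, ?_⟩
  rw [inner_add_smul, hA, hB, hC]
  push_cast
  ring

theorem smul_mem_span_pair {a b x : Plane} (c : ℝ) (hx : x ∈ Submodule.span ℤ {a, b}) :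
    c • x ∈ Submodule.span ℤ {c • a, c • b} := by
  obtain ⟨p, q, rfl⟩ := mem_span_pair_iff.mp hx
  exact mem_span_pair_iff.mpr ⟨p, q, by module⟩

theorem isSimilar_span_pair (a b : Plane) {c : ℝ} (hc : 0 < c) :
    IsSimilar (Submodule.span ℤ {a, b}) (Submodule.span ℤ {c • a, c • b}) := by
  refine ⟨c, hc, IsometryEquiv.refl _, Set.Subset.antisymm ?_ ?_⟩
  · rintro _ ⟨x, hx, rfl⟩
    exact smul_mem_span_pair c hx
  · intro y hy
    obtain ⟨p, q, rfl⟩ := mem_span_pair_iff.mp hy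
    refine ⟨(p : ℝ) • a + (q : ℝ) • b, mem_span_pair_iff.mpr ⟨p, q, rfl⟩, ?_⟩
    change c • ((p : ℝ) • a + (q : ℝ) • b) = _
    module

theorem exists_isIntegral_of_equilateral {n : ℕ} (hn : Odd n) {L : Submodule ℤ Plane}
    (hL : IsPlanarLattice L) {P : Polygon Plane n} (hP : ContainedIn P L) (hE : IsEquilateral P) :
    ∃ L' : Submodule ℤ Plane, IsPlanarLattice L' ∧ IsIntegral L' ∧ IsSimilar L L' ∧
      nu L' % 4 = 3 ∧ ∀ p : ℕ, p.Prime → p ∣ nu L' → p ≤ n := by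
  obtain ⟨a, b, hab, rfl⟩ := hL
  obtain ⟨r, hr, hE⟩ := hE
  have hn' : Odd (Fintype.card (Fin n)) := by simpa using hn
  let v : Fin n → Plane := fun i => P (finRotate n i) - P i
  have hv : ∀ i, v i ∈ Submodule.span ℤ {a, b} := fun i => Submodule.sub_mem _ (hP _) (hP _)
  have hvr : ∀ i, (inner ℝ (v i) (v i) : ℝ) = r ^ 2 := fun i => by
    rw [real_inner_self_eq_norm_sq, ← dist_eq_norm, dist_comm, hE]
  have hs : ∑ i, v i = 0 := by
    simp only [v, Finset.sum_sub_distrib]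
    rw [Equiv.sum_comp (finRotate n) (fun i => P i), sub_self]
  obtain ⟨κ, A, B, C, hκ, hA, hB, hC⟩ :=
    exists_gram_of_sum_eq_zero hn' hab (by positivity) hv hvr hs
  -- Inner products scale by the square of the factor.
  let c := Real.sqrt κ
  have hc : 0 < c := Real.sqrt_pos.mpr hκ
  have hcc : c * c = κ := Real.mul_self_sqrt hκ.le
  have hsc : ∀ u w : Plane, (inner ℝ (c • u) (c • w) : ℝ) = κ * inner ℝ u w := fun u w => by
    rw [real_inner_smul_left, real_inner_smul_right, ← mul_assoc, hcc]
  have hab' : LinearIndependent ℝ ![c • a, c • b] := by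
    apply linearIndependent_of_cross_ne_zero
    have h1 : cross (c • a) (c • b) = κ * cross a b := by rw [← hcc]; simp [cross]; ring
    rw [h1]
    exact mul_ne_zero hκ.ne' (cross_ne_zero_of_linearIndependent hab)
  have hI : IsIntegral (Submodule.span ℤ {c • a, c • b}) :=
    isIntegral_span_pair (by rw [hsc, hA]) (by rw [hsc, hB]) (by rw [hsc, hC])
  have hnu := nu_of_sum_eq_zero hn' hab' hI (R := κ * r ^ 2) (by positivity)
    (v := fun i => c • v i) (fun i => smul_mem_span_pair c (hv i))
    (fun i => by rw [hsc, hvr]) (by rw [← Finset.smul_sum, hs, smul_zero])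
  rw [Fintype.card_fin] at hnu
  exact ⟨_, ⟨_, _, hab', rfl⟩, hI, isSimilar_span_pair a b hc, hnu.1, hnu.2⟩

theorem exists_isGreatest_prime {m : ℕ} (hm : 1 < m) :
    ∃ p : ℕ, IsGreatest {q : ℕ | q.Prime ∧ q ∣ m} p := by
  have h : m.primeFactors.Nonempty := Nat.nonempty_primeFactors.mpr hm
  refine ⟨m.primeFactors.max' h, ?_, fun q hq => ?_⟩
  · exact ⟨Nat.prime_of_mem_primeFactors (Finset.max'_mem _ h),
      Nat.dvd_of_mem_primeFactors (Finset.max'_mem _ h)⟩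
  · exact Finset.le_max' _ _ (Nat.mem_primeFactors.mpr ⟨hq.1, hq.2, by omega⟩)

end PlanarLattice
end

theorem theorem3p4 (n : ℕ) (hodd : Odd n) (h3 : 3 ≤ n) (h17 : n < 17)
    (L : Submodule ℤ PlanarLattice.Plane) (hL : PlanarLattice.IsPlanarLattice L) :
    List.TFAE [
      ∃ P : Polygon PlanarLattice.Plane n,
        PlanarLattice.ContainedIn P L ∧ PlanarLattice.IsEquilateral P,
      ∃ P : Polygon PlanarLattice.Plane n, PlanarLattice.ContainedIn P L ∧
        PlanarLattice.IsEquilateral P ∧ PlanarLattice.IsSimple P,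
      ∀ k : ℕ, n ≤ k → ∃ P : Polygon PlanarLattice.Plane k, PlanarLattice.ContainedIn P L ∧
        PlanarLattice.IsEquilateral P ∧ PlanarLattice.IsConvexPolygon P,
      ∃ L' : Submodule ℤ PlanarLattice.Plane, PlanarLattice.IsPlanarLattice L' ∧
        PlanarLattice.IsIntegral L' ∧ PlanarLattice.IsSimilar L L' ∧
        PlanarLattice.nu L' ≡ 3 [MOD 4] ∧
        ∃ p : ℕ, IsGreatest {q : ℕ | q.Prime ∧ q ∣ PlanarLattice.nu L'} p ∧ p ≤ n] := by
  tfae_have 2 → 1 := fun ⟨P, hP, hE, _⟩ => ⟨P, hP, hE⟩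
  tfae_have 3 → 2 := fun h => by
    obtain ⟨P, hP, hE, hC⟩ := h n le_rfl
    exact ⟨P, hP, hE, hC.isSimple h3⟩
  tfae_have 1 → 4 := fun ⟨P, hP, hE⟩ => by
    obtain ⟨L', hL', hI, hS, h4, hp⟩ :=
      PlanarLattice.exists_isIntegral_of_equilateral hodd hL hP hE
    obtain ⟨p, hgr⟩ := PlanarLattice.exists_isGreatest_prime (m := PlanarLattice.nu L') (by omega)
    exact ⟨L', hL', hI, hS, h4, p, hgr, hp p hgr.1.1 hgr.1.2⟩
  tfae_have 4 → 3 := fun ⟨L', hL', hI, hS, h4, p, hgr, hpn⟩ k hk => by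
    obtain ⟨a, b, hab, rfl⟩ := hL
    obtain ⟨c, A, B, C, t, hc, hA, hB, hC, hm⟩ :=
      PlanarLattice.exists_gram_of_isSimilar hL' hI hS
    obtain ⟨S, hcard, hcyc⟩ := PlanarLattice.exists_isUnitCycle
      (PlanarLattice.nu_spec L' hL' hI).1 h4 h17
      (fun q hq hqm => (hgr.2 ⟨hq, hqm⟩).trans hpn) hk
    exact PlanarLattice.exists_convex_of_isUnitCycle hab hc hA hB hC hm hcyc hcard
  tfae_finish
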